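/- For $n\ge 1$ and $\tau>0$ (the undetectability level) let $a=a_n(\tau)=-\omega\!\left(-\tfrac{4\tau^2}{n}-1-i\pi\right)$, where $\omega$ is the Wright omega function; equivalently $a=-W_{-1}\!\left(-e^{-1-4\tau^2/n}\right)>1$, with $W_{-1}$ the lower real branch of the Lambert function. Let the cover $\mathbf c\in\mathbb R^n$ have the Gaussian law $P_c=\mathcal N(\mu_c,\Sigma_c)$ with $\Sigma_c$ positive definite, let the coded message $\mathbf m$ be independent of $\mathbf c$ with law $P_m=\mathcal N(0,(a-1)\Sigma_c)$, and let the stego object be $\mathbf s=\mathbf c+\mathbf m$, with law $P_s=\mathcal N(\mu_c,a\Sigma_c)$. Let $I(P_s;P_m)$ be the mutual information of $\mathbf s$ and $\mathbf m$, in nats per cover object. A codebook is a family of $\mathcal K$ vectors $\mathbf m_1,\dots,\mathbf m_{\mathcal K}\in\mathbb R^n$. To send the uniformly distributed message $i$, the sender draws a cover $\mathbf c\sim P_c$ and transmits $\mathbf s=\mathbf c+\mathbf m_i$. Given a set $A$ of pairs, the receiver, who knows the codebook and the distributions but not the realization of $\mathbf c$, decodes $\mathbf s$ as the unique $i$ with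 $(\mathbf m_i,\mathbf s)\in A$, and fails if there is no such unique $i$. Let $P_B$ be the probability of decoding error when the codewords are drawn independently from $P_m$, and let $P_B(\mathcal C)$ be the (message-averaged) error probability of a fixed codebook $\mathcal C$. Let $A_\gamma$ be the jointly typical set: the pairs $(\mathbf m,\mathbf s)$ for which $-\frac1n\ln p$ differs by less than $\gamma$ from $\frac1n h$ for each of the densities $p_m$, $p_s$, $p_{m,s}$, where $h$ is the differential entropy of that density. Then: 1. $I(P_s;P_m)=\frac n2\ln a_n(\tau)$ for all $n\ge1$, $\tau>0$. 2. (Rate in nats per cover element.) For all $\varepsilon,\delta>0$ and $0<\gamma<\frac23\varepsilon$ there is $N$ such that for all $n\ge N$, all $\tau>0$, all $\mu_c,\Sigma_c$, and every rate $R\le \frac1n I(P_s;P_m)-2\varepsilon$, the random code with $\mathcal K=\lceil e^{nR}\rceil$ codewords and the decoder with $A=A_\gamma$ satisfies $P_B\le 2\delta$. Hence there is a codebook $\mathcal C$ with $\lceil e^{nR}\rceil$ codewords and $P_B(\mathcal C)\le2\delta$ under the same decoder. 3. (Fixed undetectability level, rate in nats per $\sqrt n$.) For all $\tau,\varepsilon,\delta,\gamma>0$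 there is $N$ such that for all $n\ge N$, all $\mu_c,\Sigma_c$, and every $R\le \frac1{\sqrt n}I(P_s;P_m)-2\varepsilon$, the random code with $\mathcal K=\lceil e^{\sqrt n R}\rceil$ codewords and the decoder with $A=\left\{(\mathbf m,\mathbf s)\in A_\gamma:\left|\ln\frac{p_{m,s}(\mathbf m,\mathbf s)}{p_m(\mathbf m)p_s(\mathbf s)}-I(P_s;P_m)\right|<\varepsilon\sqrt n\right\}$ satisfies $P_B\le2\delta$. Hence there is a codebook $\mathcal C$ with $\lceil e^{\sqrt n R}\rceil$ codewords and $P_B(\mathcal C)\le2\delta$ under the same decoder. -/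

import Mathlib

open MeasureTheory ProbabilityTheory Matrix

namespace Stego

noncomputable section

/-- The real branch `W₋₁` of the Lambert W function: for `-1/e ≤ y < 0`, the unique `w ≤ -1`
with `w * exp w = y`. -/
def lambertWNegOne (y : ℝ) : ℝ :=
  sInf {w : ℝ | w ≤ -1 ∧ w * Real.exp w = y}

/-- The value `ω(x - iπ)` (for real `x ≤ -1`) of the Wright omega function
`ω(z) = W_{⌈(Im z - π) / (2π)⌉}(exp z)`: the branch index is `-1`, and `exp (x - iπ) = -exp x`. -/
def wrightOmegaSubPiI (x : ℝ) : ℝ :=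
  lambertWNegOne (-Real.exp x)

/-- The embedding factor `a = -ω(-4τ²/n - 1 - iπ)` for `n` cover elements and undetectability
level `τ`. -/
def embeddingFactor (n : ℕ) (τ : ℝ) : ℝ :=
  -wrightOmegaSubPiI (-(4 * τ ^ 2 / n) - 1)

/-- Vectors with `n` real elements (covers, stego objects, coded messages). -/
abbrev Vec (n : ℕ) : Type := EuclideanSpace ℝ (Fin n)

/-- The law `P_c` of the cover object. -/
def coverLaw {n : ℕ} (μ : Vec n) (S : Matrix (Fin n) (Fin n) ℝ) : Measure (Vec n) :=
  multivariateGaussian μ S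

/-- The law `P_m` of the coded message: centred Gaussian with covariance `(a - 1) Σ_c`. -/
def messageLaw {n : ℕ} (τ : ℝ) (S : Matrix (Fin n) (Fin n) ℝ) : Measure (Vec n) :=
  multivariateGaussian 0 ((embeddingFactor n τ - 1) • S)

/-- The joint law of `(m, s)`, where `s = c + m` and the cover `c` and the coded message `m` are
independent. -/
def messageStegoLaw {n : ℕ} (τ : ℝ) (μ : Vec n) (S : Matrix (Fin n) (Fin n) ℝ) :
    Measure (Vec n × Vec n) :=
  ((messageLaw τ S).prod (coverLaw μ S)).map (fun p => (p.1, p.2 + p.1))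

/-- Mutual information (in nats) of a pair with joint law `ρ`. -/
def mutualInfo {α β : Type*} [MeasurableSpace α] [MeasurableSpace β] (ρ : Measure (α × β)) :
    ENNReal :=
  InformationTheory.klDiv ρ (ρ.fst.prod ρ.snd)

/-- `I(P_s; P_m)`: mutual information between the stego object and the coded message, in nats
per cover object. -/
def stegoInfo {n : ℕ} (τ : ℝ) (μ : Vec n) (S : Matrix (Fin n) (Fin n) ℝ) : ENNReal :=
  mutualInfo (messageStegoLaw τ μ S)

/-- The density of the nondegenerate Gaussian distribution `N(μ, S)`. -/
def gaussianDensity {n : ℕ} (μ : Vec n) (S : Matrix (Fin n) (Fin n) ℝ) (x : Vec n) : ℝ :=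
  (Real.sqrt ((2 * Real.pi) ^ n * S.det))⁻¹ *
    Real.exp (-((x - μ).ofLp ⬝ᵥ (S⁻¹ *ᵥ (x - μ).ofLp)) / 2)

/-- The density `p_m` of the coded message. -/
def messageDensity {n : ℕ} (τ : ℝ) (S : Matrix (Fin n) (Fin n) ℝ) : Vec n → ℝ :=
  gaussianDensity 0 ((embeddingFactor n τ - 1) • S)

/-- The density `p_s` of the stego object, Gaussian with mean `μ_c` and covariance `a Σ_c`. -/
def stegoDensity {n : ℕ} (τ : ℝ) (μ : Vec n) (S : Matrix (Fin n) (Fin n) ℝ) : Vec n → ℝ :=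
  gaussianDensity μ (embeddingFactor n τ • S)

/-- The joint density of `(m, s)`, `s = c + m`. -/
def messageStegoDensity {n : ℕ} (τ : ℝ) (μ : Vec n) (S : Matrix (Fin n) (Fin n) ℝ) :
    Vec n × Vec n → ℝ :=
  fun p => messageDensity τ S p.1 * gaussianDensity μ S (p.2 - p.1)

/-- Differential entropy `-∫ f log f` of a density, in nats. -/
def differentialEntropy {α : Type*} [MeasureSpace α] (f : α → ℝ) : ℝ :=
  ∫ x, Real.negMulLog (f x)

/-- `x` is weakly typical for the density `f`: `|-(1/n) log f(x) - h(f)/n| < γ`. -/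
def IsTypical {α : Type*} [MeasureSpace α] (n : ℕ) (γ : ℝ) (f : α → ℝ) (x : α) : Prop :=
  |-(1 / (n : ℝ)) * Real.log (f x) - differentialEntropy f / n| < γ

/-- The jointly typical set: pairs `(m, s)` such that `m`, `s` and `(m, s)` are all weakly
typical for their respective densities. -/
def jointlyTypicalSet {n : ℕ} (γ τ : ℝ) (μ : Vec n) (S : Matrix (Fin n) (Fin n) ℝ) :
    Set (Vec n × Vec n) :=
  {p | IsTypical n γ (messageDensity τ S) p.1 ∧ IsTypical n γ (stegoDensity τ μ S) p.2 ∧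
    IsTypical n γ (messageStegoDensity τ μ S) p}

/-- The information density `log (p(m, s) / (p_m(m) p_s(s)))`. -/
def infoDensity {n : ℕ} (τ : ℝ) (μ : Vec n) (S : Matrix (Fin n) (Fin n) ℝ)
    (p : Vec n × Vec n) : ℝ :=
  Real.log (messageStegoDensity τ μ S p /
    (messageDensity τ S p.1 * stegoDensity τ μ S p.2))

/-- Jointly typical pairs whose information density, moreover, differs from the mutual information
by less than `t`. -/
def refinedTypicalSet {n : ℕ} (γ t τ : ℝ) (μ : Vec n) (S : Matrix (Fin n) (Fin n) ℝ) :
    Set (Vec n × Vec n) :=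
  {p ∈ jointlyTypicalSet γ τ μ S | |infoDensity τ μ S p - (stegoInfo τ μ S).toReal| < t}

open Classical in
/-- The joint typicality decoder for the set `A` of typical pairs: given the codebook `C` and the
received stego object `s`, it outputs the index `i` if `i` is the only index with `(C i, s) ∈ A`,
and declares a failure (`none`) if there is no such index. It does not see the cover. -/
def typicalDecoder {n K : ℕ} (A : Set (Vec n × Vec n)) (C : Fin K → Vec n) (s : Vec n) :
    Option (Fin K) :=
  if h : ∃! i, (C i, s) ∈ A then some h.choose else none

/-- Probability of decoding error, averaged over `K` equiprobable messages, for the codebook `C`: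
message `i` is embedded as `s = c + C i` in a cover `c` with law `P`. -/
def codebookError {n K : ℕ} (A : Set (Vec n × Vec n)) (P : Measure (Vec n))
    (C : Fin K → Vec n) : ℝ :=
  (1 / (K : ℝ)) * ∑ i, P.real {c | typicalDecoder A C (c + C i) ≠ some i}

/-- Probability `P_B` of decoding error of the random code: the `K` codewords are drawn
independently from the law `Q`, independently of the cover, which has law `P`, and of the
message, which is uniform on the `K` indices. -/
def randomCodeError {n : ℕ} (K : ℕ) (A : Set (Vec n × Vec n)) (Q P : Measure (Vec n)) : ℝ :=
  (1 / (K : ℝ)) * ∑ i : Fin K, ((Measure.pi fun _ : Fin K => Q).prod P).real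
    {ω | typicalDecoder A ω.1 (ω.2 + ω.1 i) ≠ some i}

end

end Stego

namespace Stego

open scoped MatrixOrder RealInnerProductSpace ENNReal

/-! Everything is governed by the information density `i(m, s)`, the logarithm of the joint density
over the product of its marginals. Write `Q_T(x) = xᵀ T⁻¹ x`. The message density cancels in the
quotient, leaving `i = (n/2) log a + Q_{aS}(s - μ)/2 - Q_S(s - m - μ)/2` (`infoDensity_eq`). For a
Gaussian vector with covariance `T`, the centred form `Q_T` is distributed as the squared norm of a
standard Gaussian vector, so it has mean `n` and variance proportional to `n`, whatever `T` is.
Hence `i` has mean `(n/2) log a`, which is the mutual information (`stegoInfo_eq`).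

Random coding with a union bound (`randomCodeError_le`) bounds the error by the probability that the
true pair lies outside `A`, plus `K - 1` times the probability that an independent pair lies in `A`.
Since `exp i` is the density of the joint law with respect to the product of its marginals, the
latter probability is at most `exp (-t)` when `i ≥ t` on `A` (`independent_measure_le`). A codebook
at least as good as the average exists by Fubini.

For rates per element, typicality forces `i` to within `3γn` of its mean, and Chebyshev bounds the
atypical probability by a multiple of `1/n` free of `τ`, `μ` and `S`. For rates per `√n`, that slack
is too coarse and `i` itself is controlled: its deviations at scale `ε√n` have probability of order
`((a - 1)² + (a - 1)) / ε²` (`infoDensity_deviation_le`). The factor `n` cancels, and the bound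
vanishes because `a → 1` for fixed `τ` (`tendsto_embeddingFactor`). -/

/-! ### Densities of nondegenerate Gaussian laws -/

theorem map_withDensity_comp {α β : Type*} [MeasurableSpace α] [MeasurableSpace β]
    (μ : Measure α) {e : α → β} (he : Measurable e) {g : β → ℝ≥0∞} (hg : Measurable g) :
    (μ.withDensity (g ∘ e)).map e = (μ.map e).withDensity g := by
  ext s hs
  rw [Measure.map_apply he hs, withDensity_apply _ (he hs), withDensity_apply _ hs,
    setLIntegral_map hs hg he]
  rfl

theorem pi_gaussianReal_eq_withDensity (n : ℕ) :
    Measure.pi (fun _ : Fin n => gaussianReal 0 1) =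
      volume.withDensity (fun x => ENNReal.ofReal (∏ i, gaussianPDFReal 0 1 (x i))) := by
  refine Measure.pi_eq fun s hs => ?_
  rw [withDensity_apply _ (MeasurableSet.univ_pi hs),
    ← ofReal_integral_eq_lintegral_ofReal]
  · rw [volume_pi, Measure.restrict_pi_pi, integral_fintype_prod_eq_prod,
      ENNReal.ofReal_prod_of_nonneg
        (fun i _ => integral_nonneg fun x => gaussianPDFReal_nonneg 0 1 x)]
    simp_rw [gaussianReal_apply_eq_integral 0 one_ne_zero]
  · exact (Integrable.fintype_prod fun _ => integrable_gaussianPDFReal 0 1).integrableOn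
  · exact ae_of_all _ fun x => Finset.prod_nonneg fun i _ => gaussianPDFReal_nonneg 0 1 _

theorem stdGaussian_eq_withDensity (n : ℕ) :
    stdGaussian (Vec n) = volume.withDensity
      (fun x => ENNReal.ofReal ((Real.sqrt ((2 * Real.pi) ^ n))⁻¹ * Real.exp (-‖x‖ ^ 2 / 2))) := by
  rw [← map_pi_eq_stdGaussian, pi_gaussianReal_eq_withDensity,
    ← (PiLp.volume_preserving_toLp (Fin n)).map_eq,
    ← map_withDensity_comp _ (by fun_prop) (by fun_prop)]
  congr 2
  ext x
  simp only [Function.comp_apply, gaussianPDFReal, Finset.prod_mul_distrib, ← Real.exp_sum,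
    EuclideanSpace.real_norm_sq_eq]
  congr 2
  · have h : Real.sqrt (2 * Real.pi) ^ n = Real.sqrt ((2 * Real.pi) ^ n) := by
      rw [eq_comm, Real.sqrt_eq_iff_mul_self_eq (by positivity) (by positivity), ← mul_pow,
        Real.mul_self_sqrt Real.two_pi_pos.le]
    rw [Finset.prod_const, Finset.card_univ, Fintype.card_fin, NNReal.coe_one, mul_one, inv_pow, h]
  · simp [Finset.sum_div, neg_div]

theorem sqrt_mul_self_of_posDef {n : ℕ} {S : Matrix (Fin n) (Fin n) ℝ} (hS : S.PosDef) :
    CFC.sqrt S * CFC.sqrt S = S :=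
  CFC.sqrt_mul_sqrt_self _ hS.posSemidef.nonneg

theorem transpose_sqrt {n : ℕ} (S : Matrix (Fin n) (Fin n) ℝ) :
    (CFC.sqrt S)ᵀ = CFC.sqrt S := by
  have h : IsSelfAdjoint (CFC.sqrt S) := (CFC.sqrt_nonneg S).isSelfAdjoint
  simpa [IsSelfAdjoint, star_eq_conjTranspose, conjTranspose_eq_transpose_of_trivial] using h

theorem det_sqrt_mul_self {n : ℕ} {S : Matrix (Fin n) (Fin n) ℝ} (hS : S.PosDef) :
    (CFC.sqrt S).det * (CFC.sqrt S).det = S.det := by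
  rw [← det_mul, sqrt_mul_self_of_posDef hS]

theorem det_sqrt_ne_zero {n : ℕ} {S : Matrix (Fin n) (Fin n) ℝ} (hS : S.PosDef) :
    (CFC.sqrt S).det ≠ 0 := by
  intro h
  have := det_sqrt_mul_self hS
  rw [h, mul_zero] at this
  exact hS.det_pos.ne this

/-- The quadratic form `xᵀ S⁻¹ x`. -/
noncomputable def precisionForm {n : ℕ} (S : Matrix (Fin n) (Fin n) ℝ) (x : Vec n) : ℝ :=
  x.ofLp ⬝ᵥ (S⁻¹ *ᵥ x.ofLp)

theorem continuous_precisionForm {n : ℕ} (S : Matrix (Fin n) (Fin n) ℝ) :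
    Continuous (precisionForm S) := by
  unfold precisionForm
  fun_prop

@[fun_prop]
theorem measurable_precisionForm {n : ℕ} (S : Matrix (Fin n) (Fin n) ℝ) :
    Measurable (precisionForm S) := (continuous_precisionForm S).measurable

/-- With `B` the symmetric square root of `S`, `B S⁻¹ B = 1`. This reduces every quadratic form in a
Gaussian vector to the squared norm of a standard one. -/
theorem precisionForm_sqrt {n : ℕ} {S : Matrix (Fin n) (Fin n) ℝ} (hS : S.PosDef) (x : Vec n) :
    precisionForm S (toEuclideanCLM (𝕜 := ℝ) (CFC.sqrt S) x) = ‖x‖ ^ 2 := by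
  have hB : IsUnit (CFC.sqrt S).det := isUnit_iff_ne_zero.mpr (det_sqrt_ne_zero hS)
  have h : CFC.sqrt S * S⁻¹ * CFC.sqrt S = 1 := by
    conv_lhs => rw [← sqrt_mul_self_of_posDef hS]
    -- The preceding rewrite also replaced `S` inside the square roots; `CFC.sqrt_mul_self` restores
    -- them.
    rw [CFC.sqrt_mul_self _ (CFC.sqrt_nonneg S), Matrix.mul_inv_rev, ← mul_assoc,
      Matrix.mul_nonsing_inv _ hB, one_mul, Matrix.nonsing_inv_mul _ hB]
  rw [precisionForm, ofLp_toEuclideanCLM, ← transpose_sqrt, mulVec_transpose,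
    ← dotProduct_mulVec, ← mulVec_transpose, transpose_sqrt, mulVec_mulVec, mulVec_mulVec, h, one_mulVec,
    EuclideanSpace.real_norm_sq_eq]
  simp [dotProduct, sq]

theorem gaussianDensity_pos {n : ℕ} (μ : Vec n) {S : Matrix (Fin n) (Fin n) ℝ} (hS : S.PosDef)
    (x : Vec n) : 0 < gaussianDensity μ S x := by
  have := hS.det_pos
  have := Real.pi_pos
  unfold gaussianDensity
  positivity

theorem gaussianDensity_eq {n : ℕ} (μ : Vec n) (S : Matrix (Fin n) (Fin n) ℝ) (x : Vec n) :
    gaussianDensity μ S x = (Real.sqrt ((2 * Real.pi) ^ n * S.det))⁻¹ *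
      Real.exp (-precisionForm S (x - μ) / 2) := rfl

@[fun_prop]
theorem measurable_gaussianDensity {n : ℕ} (μ : Vec n) (S : Matrix (Fin n) (Fin n) ℝ) :
    Measurable (gaussianDensity μ S) := by
  rw [funext (gaussianDensity_eq μ S)]
  fun_prop

theorem log_gaussianDensity {n : ℕ} (μ : Vec n) {S : Matrix (Fin n) (Fin n) ℝ} (hS : S.PosDef)
    (x : Vec n) : Real.log (gaussianDensity μ S x) =
      -(Real.log ((2 * Real.pi) ^ n * S.det) / 2) - precisionForm S (x - μ) / 2 := by
  have := hS.det_pos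
  have := Real.pi_pos
  rw [gaussianDensity_eq, Real.log_mul (by positivity) (by positivity), Real.log_inv,
    Real.log_sqrt (by positivity), Real.log_exp]
  ring

/-- Change of variables along `x ↦ μ + B x`, under which Lebesgue measure is scaled by `|det B|⁻¹`;
the identity `|det B| = √(det S)` gives the normalizing constant. -/
theorem multivariateGaussian_eq_withDensity {n : ℕ} (μ : Vec n) {S : Matrix (Fin n) (Fin n) ℝ}
    (hS : S.PosDef) : multivariateGaussian μ S =
      volume.withDensity (fun x => ENNReal.ofReal (gaussianDensity μ S x)) := by
  have hd := det_sqrt_ne_zero hS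
  set B := CFC.sqrt S with hB
  let L : Vec n →ₗ[ℝ] Vec n := toEuclideanLin B
  have hdet : LinearMap.det L = B.det := by
    simp only [L, toEuclideanLin_eq_toLin_orthonormal, LinearMap.det_toLin]
  have hvol : (volume : Measure (Vec n)).map (fun x => μ + toEuclideanCLM (𝕜 := ℝ) B x) =
      ENNReal.ofReal |B.det⁻¹| • volume := by
    have h1 : (fun x => μ + toEuclideanCLM (𝕜 := ℝ) B x) = (fun x => μ + x) ∘ L := rfl
    rw [h1, ← Measure.map_map (by fun_prop) L.continuous_of_finiteDimensional.measurable,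
      Measure.map_linearMap_addHaar_eq_smul_addHaar _ (by rwa [hdet]), Measure.map_smul,
      map_add_left_eq_self, hdet]
  have hψ : (fun x : Vec n =>
      ENNReal.ofReal ((Real.sqrt ((2 * Real.pi) ^ n))⁻¹ * Real.exp (-‖x‖ ^ 2 / 2))) =
      (fun y => ENNReal.ofReal (|B.det| * gaussianDensity μ S y)) ∘
        (fun x => μ + toEuclideanCLM (𝕜 := ℝ) B x) := by
    ext x
    have h2 : Real.sqrt S.det = |B.det| := by
      rw [← det_sqrt_mul_self hS, Real.sqrt_mul_self_eq_abs]
    have h3 : |B.det| ≠ 0 := abs_ne_zero.mpr hd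
    simp only [Function.comp_apply, gaussianDensity_eq, add_sub_cancel_left]
    rw [hB, precisionForm_sqrt hS, ← hB, Real.sqrt_mul (by positivity), h2]
    congr 1
    field_simp
  rw [multivariateGaussian, stdGaussian_eq_withDensity, ← hB, hψ,
    map_withDensity_comp _ (by fun_prop) (by fun_prop), hvol, withDensity_smul_measure,
    ← withDensity_smul _ (by fun_prop)]
  congr 1
  ext x
  rw [Pi.smul_apply, smul_eq_mul, ← ENNReal.ofReal_mul (by positivity), ← mul_assoc, abs_inv,
    inv_mul_cancel₀ (abs_ne_zero.mpr hd), one_mul]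

/-! ### Mean and concentration of the quadratic form -/

/-- The variance of the square of a standard Gaussian variable. -/
noncomputable def chiSqVariance : ℝ := Var[fun x => x ^ 2; gaussianReal 0 1]

theorem chiSqVariance_nonneg : 0 ≤ chiSqVariance := variance_nonneg _ _

theorem memLp_sq_gaussianReal : MemLp (fun x : ℝ => x ^ 2) 2 (gaussianReal 0 1) := by
  have h : MemLp (fun x : ℝ => x) 4 (gaussianReal 0 1) := memLp_id_gaussianReal' 4 (by simp)
  rw [memLp_two_iff_integrable_sq (by fun_prop)]
  have h4 := h.integrable_norm_pow (p := 4) (by norm_num)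
  refine h4.congr (ae_of_all _ fun x => ?_)
  simp only [Real.norm_eq_abs]
  rw [← pow_mul, (by decide : Even 4).pow_abs]

theorem integral_sq_gaussianReal : ∫ x : ℝ, x ^ 2 ∂(gaussianReal 0 1) = 1 := by
  have h := variance_id_gaussianReal (μ := 0) (v := 1)
  rw [variance_of_integral_eq_zero (by fun_prop) (by simp)] at h
  simpa using h

theorem memLp_norm_sq_stdGaussian (n : ℕ) :
    MemLp (fun x : Vec n => ‖x‖ ^ 2) 2 (stdGaussian (Vec n)) := by
  rw [← map_pi_eq_stdGaussian, memLp_map_measure_iff (by fun_prop) (by fun_prop)]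
  simp only [Function.comp_def, EuclideanSpace.real_norm_sq_eq]
  exact memLp_finsetSum _ fun i _ =>
    memLp_sq_gaussianReal.comp_measurePreserving (measurePreserving_eval _ i)

theorem integral_norm_sq_stdGaussian (n : ℕ) :
    ∫ x : Vec n, ‖x‖ ^ 2 ∂(stdGaussian (Vec n)) = n := by
  rw [← map_pi_eq_stdGaussian, integral_map (by fun_prop) (by fun_prop)]
  simp only [EuclideanSpace.real_norm_sq_eq]
  have hi : Integrable (fun x : ℝ => x ^ 2) (gaussianReal 0 1) :=
    memLp_sq_gaussianReal.integrable (by norm_num)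
  rw [integral_finsetSum _ fun i _ =>
    integrable_comp_eval (μ := fun _ : Fin n => gaussianReal 0 1) hi]
  simp_rw [integral_comp_eval (μ := fun _ : Fin n => gaussianReal 0 1) hi.aestronglyMeasurable,
    integral_sq_gaussianReal]
  simp

/-- The coordinates are independent, so variances add. Only linear growth in `n` matters later; the
numerical value of `chiSqVariance` does not. -/
theorem variance_norm_sq_stdGaussian (n : ℕ) :
    Var[fun x : Vec n => ‖x‖ ^ 2; stdGaussian (Vec n)] = n * chiSqVariance := by
  rw [← map_pi_eq_stdGaussian, variance_map (by fun_prop) (by fun_prop)]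
  have h := variance_sum_pi (μ := fun _ : Fin n => gaussianReal 0 1)
    (X := fun _ x => x ^ 2) fun _ => memLp_sq_gaussianReal
  have e : (fun x : Vec n => ‖x‖ ^ 2) ∘ WithLp.toLp 2 =
      ∑ i : Fin n, fun ω : Fin n → ℝ => ω i ^ 2 := by
    ext x
    simp [EuclideanSpace.real_norm_sq_eq]
  rw [e, h]
  simp [chiSqVariance]

theorem integrable_precisionForm {n : ℕ} (μ : Vec n) {S : Matrix (Fin n) (Fin n) ℝ}
    (hS : S.PosDef) :
    Integrable (fun x => precisionForm S (x - μ)) (multivariateGaussian μ S) := by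
  rw [multivariateGaussian, integrable_map_measure
    (Measurable.aestronglyMeasurable (by fun_prop)) (by fun_prop)]
  simp only [Function.comp_def, add_sub_cancel_left, precisionForm_sqrt hS]
  exact (memLp_norm_sq_stdGaussian n).integrable (by norm_num)

theorem integral_precisionForm {n : ℕ} (μ : Vec n) {S : Matrix (Fin n) (Fin n) ℝ}
    (hS : S.PosDef) :
    ∫ x, precisionForm S (x - μ) ∂(multivariateGaussian μ S) = n := by
  rw [multivariateGaussian, integral_map (by fun_prop)
    (Measurable.aestronglyMeasurable (by fun_prop))]
  simp only [add_sub_cancel_left, precisionForm_sqrt hS]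
  exact integral_norm_sq_stdGaussian n

theorem measure_precisionForm_sub_ge_le {n : ℕ} (μ : Vec n) {S : Matrix (Fin n) (Fin n) ℝ}
    (hS : S.PosDef) {t : ℝ} (ht : 0 < t) :
    multivariateGaussian μ S {x | t ≤ |precisionForm S (x - μ) - n|} ≤
      ENNReal.ofReal (n * chiSqVariance / t ^ 2) := by
  rw [multivariateGaussian, Measure.map_apply (by fun_prop)
    (measurableSet_le (by fun_prop) (by fun_prop))]
  simp only [Set.preimage_ofPred_eq, add_sub_cancel_left, precisionForm_sqrt hS]
  have h := meas_ge_le_variance_div_sq (memLp_norm_sq_stdGaussian n) ht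
  rwa [integral_norm_sq_stdGaussian, variance_norm_sq_stdGaussian] at h

/-! ### Entropy, convolution and second moments of Gaussian laws -/

theorem differentialEntropy_eq_of_withDensity {α : Type*} [MeasureSpace α] {f : α → ℝ}
    (hf : Measurable f) (hf0 : ∀ x, 0 ≤ f x) {ρ : Measure α}
    (hρ : ρ = volume.withDensity (fun x => ENNReal.ofReal (f x))) :
    differentialEntropy f = -∫ x, Real.log (f x) ∂ρ := by
  rw [hρ, integral_withDensity_eq_integral_toReal_smul (by fun_prop) (by simp), differentialEntropy,
    ← integral_neg]
  simp [Real.negMulLog, ENNReal.toReal_ofReal (hf0 _)]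

theorem differentialEntropy_gaussianDensity {n : ℕ} (μ : Vec n) {S : Matrix (Fin n) (Fin n) ℝ}
    (hS : S.PosDef) : differentialEntropy (gaussianDensity μ S) =
      Real.log ((2 * Real.pi) ^ n * S.det) / 2 + n / 2 := by
  rw [differentialEntropy_eq_of_withDensity (by fun_prop) (fun x => (gaussianDensity_pos μ hS x).le)
    (multivariateGaussian_eq_withDensity μ hS)]
  simp_rw [log_gaussianDensity μ hS]
  rw [integral_sub (integrable_const _) ((integrable_precisionForm μ hS).div_const _),
    integral_div, integral_precisionForm μ hS]
  simp
  ring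

/-- Characteristic functions multiply. This identifies the law of the stego object. -/
theorem multivariateGaussian_conv {n : ℕ} (μ ν : Vec n) {S T : Matrix (Fin n) (Fin n) ℝ}
    (hS : S.PosSemidef) (hT : T.PosSemidef) :
    multivariateGaussian μ S ∗ multivariateGaussian ν T =
      multivariateGaussian (μ + ν) (S + T) := by
  refine Measure.ext_of_charFun ?_
  ext t
  rw [charFun_conv, charFun_multivariateGaussian hS, charFun_multivariateGaussian hT,
    charFun_multivariateGaussian (hS.add hT), ← Complex.exp_add, inner_add_right, add_mulVec,
    dotProduct_add]
  push_cast
  congr 1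
  ring

theorem lintegral_dotProduct_sq_multivariateGaussian {n : ℕ} {S : Matrix (Fin n) (Fin n) ℝ}
    (hS : S.PosSemidef) (u : Fin n → ℝ) :
    ∫⁻ x : Vec n, ENNReal.ofReal ((u ⬝ᵥ x.ofLp) ^ 2) ∂(multivariateGaussian 0 S) =
      ENNReal.ofReal (u ⬝ᵥ S *ᵥ u) := by
  have hm : MemLp id 2 (multivariateGaussian (0 : Vec n) S) := IsGaussian.memLp_two_id
  have h := covarianceBilin_multivariateGaussian (μ := 0) hS (WithLp.toLp 2 u) (WithLp.toLp 2 u)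
  rw [covarianceBilin_self hm] at h
  have e : (fun x : Vec n => ⟪WithLp.toLp 2 u, x⟫) = fun x => u ⬝ᵥ x.ofLp := by
    ext x; simp [PiLp.inner_apply, dotProduct, mul_comm]
  have h0 : ∫ x : Vec n, u ⬝ᵥ x.ofLp ∂(multivariateGaussian 0 S) = 0 := by
    rw [← e, integral_inner (c := WithLp.toLp 2 u) (f := fun x => x) IsGaussian.integrable_fun_id]
    simp
  have hX : MemLp (fun x : Vec n => u ⬝ᵥ x.ofLp) 2 (multivariateGaussian 0 S) := by
    rw [← e]
    exact hm.const_inner _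
  rw [e, variance_of_integral_eq_zero hX.aestronglyMeasurable.aemeasurable h0] at h
  rw [← ofReal_integral_eq_lintegral_ofReal hX.integrable_sq (ae_of_all _ fun x => sq_nonneg _)]
  exact congrArg _ h

/-! ### Joint typicality decoding and the random coding bound -/

theorem typicalDecoder_eq_some_iff {n K : ℕ} (A : Set (Vec n × Vec n)) (C : Fin K → Vec n)
    (s : Vec n) (i : Fin K) :
    typicalDecoder A C s = some i ↔ (C i, s) ∈ A ∧ ∀ j, j ≠ i → (C j, s) ∉ A := by
  unfold typicalDecoder
  constructor
  · intro h
    split_ifs at h with hu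
    have hi : hu.choose = i := Option.some.inj h
    have hs := hu.choose_spec
    rw [hi] at hs
    exact ⟨hs.1, fun j hj hjA => hj (hs.2 j hjA)⟩
  · rintro ⟨h1, h2⟩
    have hu : ∃! j, (C j, s) ∈ A := ⟨i, h1, fun j hj => by_contra fun hne => h2 j hne hj⟩
    rw [dif_pos hu]
    exact congrArg some (by_contra fun hne => h2 _ hne hu.choose_spec.1)

/-- The joint law of a codeword `m` and the object `c + m`, where `m` has law `Q` and `c` has law
`P`. -/
noncomputable def channelLaw {n : ℕ} (Q P : Measure (Vec n)) : Measure (Vec n × Vec n) :=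
  (Q.prod P).map (fun p => (p.1, p.2 + p.1))

instance {n : ℕ} (Q P : Measure (Vec n)) [IsProbabilityMeasure Q] [IsProbabilityMeasure P] :
    IsProbabilityMeasure (channelLaw Q P) :=
  Measure.isProbabilityMeasure_map (by fun_prop)

theorem measurableSet_decoder_error {n K : ℕ} {A : Set (Vec n × Vec n)} (hA : MeasurableSet A)
    (i : Fin K) :
    MeasurableSet {ω : (Fin K → Vec n) × Vec n | typicalDecoder A ω.1 (ω.2 + ω.1 i) ≠ some i} := by
  have h : ∀ j : Fin K, MeasurableSet {ω : (Fin K → Vec n) × Vec n | (ω.1 j, ω.2 + ω.1 i) ∈ A} :=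
    fun j => hA.preimage (f := fun ω : (Fin K → Vec n) × Vec n => (ω.1 j, ω.2 + ω.1 i))
      (by fun_prop)
  have h' : MeasurableSet (⋂ j, ⋂ _ : j ≠ i,
      {ω : (Fin K → Vec n) × Vec n | (ω.1 j, ω.2 + ω.1 i) ∈ A}ᶜ) :=
    MeasurableSet.iInter fun j => MeasurableSet.iInter fun _ => (h j).compl
  have e : {ω : (Fin K → Vec n) × Vec n | typicalDecoder A ω.1 (ω.2 + ω.1 i) ≠ some i} =
      ({ω | (ω.1 i, ω.2 + ω.1 i) ∈ A} ∩ ⋂ j, ⋂ _ : j ≠ i,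
        {ω : (Fin K → Vec n) × Vec n | (ω.1 j, ω.2 + ω.1 i) ∈ A}ᶜ)ᶜ := by
    ext ω
    simp [typicalDecoder_eq_some_iff]
  rw [e]
  exact ((h i).inter h').compl

theorem map_codeword_channel {n K : ℕ} (Q P : Measure (Vec n)) [IsProbabilityMeasure Q]
    [IsProbabilityMeasure P] (i : Fin K) :
    ((Measure.pi fun _ : Fin K => Q).prod P).map (fun ω => (ω.1 i, ω.2 + ω.1 i)) =
      channelLaw Q P := by
  have h := (measurePreserving_eval (fun _ : Fin K => Q) i).prod (MeasurePreserving.id P)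
  rw [channelLaw, ← h.map_eq, Measure.map_map (by fun_prop) (by fun_prop)]
  rfl

/-- The received object depends only on codeword `i` and the cover, so a different codeword `j` is
independent of it. -/
theorem map_other_codeword_channel {n K : ℕ} (Q P : Measure (Vec n)) [IsProbabilityMeasure Q]
    [IsProbabilityMeasure P] {i j : Fin K} (hij : j ≠ i) :
    ((Measure.pi fun _ : Fin K => Q).prod P).map (fun ω => (ω.1 j, ω.2 + ω.1 i)) =
      Q.prod (channelLaw Q P).snd := by
  have hind : iIndepFun (fun (k : Fin K) (ω : Fin K → Vec n) => ω k)
      (Measure.pi fun _ : Fin K => Q) :=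
    iIndepFun_pi (X := fun _ x => x) fun _ => aemeasurable_id
  have h1 : (Measure.pi fun _ : Fin K => Q).map (fun ω => (ω j, ω i)) = Q.prod Q := by
    rw [(indepFun_iff_map_prod_eq_prod_map_map (measurable_pi_apply j).aemeasurable
      (measurable_pi_apply i).aemeasurable).mp
      (hind.indepFun hij)]
    congr 1
    · exact (measurePreserving_eval (fun _ : Fin K => Q) j).map_eq
    · exact (measurePreserving_eval (fun _ : Fin K => Q) i).map_eq
  have h2 : MeasurePreserving (fun ω : Fin K → Vec n => (ω j, ω i))
      (Measure.pi fun _ : Fin K => Q) (Q.prod Q) := ⟨by fun_prop, h1⟩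
  have h3 : (channelLaw Q P).snd = (Q.prod P).map (fun p => p.2 + p.1) := by
    rw [Measure.snd, channelLaw, Measure.map_map (by fun_prop) (by fun_prop)]
    rfl
  have h4 : MeasurePreserving (fun p : Vec n × Vec n => p.2 + p.1) (Q.prod P)
      (channelLaw Q P).snd := ⟨by fun_prop, h3.symm⟩
  have : IsProbabilityMeasure (channelLaw Q P).snd := inferInstance
  have h5 := ((MeasurePreserving.id Q).prod h4).comp
    ((measurePreserving_prodAssoc Q Q P).comp (h2.prod (MeasurePreserving.id P)))
  exact h5.map_eq

/-- Decoding fails only if the true pair is outside `A` or one of the `K - 1` competing codewords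
forms a pair in `A`; the union bound applies. -/
theorem randomCodeError_le {n K : ℕ} (hK : 1 ≤ K) {A : Set (Vec n × Vec n)} (hA : MeasurableSet A)
    (Q P : Measure (Vec n)) [IsProbabilityMeasure Q] [IsProbabilityMeasure P] :
    randomCodeError K A Q P ≤ (channelLaw Q P).real Aᶜ +
      ((K : ℝ) - 1) * (Q.prod (channelLaw Q P).snd).real A := by
  have hK0 : (K : ℝ) ≠ 0 := by positivity
  set M := (Measure.pi fun _ : Fin K => Q).prod P
  suffices h : ∀ i : Fin K, M.real {ω | typicalDecoder A ω.1 (ω.2 + ω.1 i) ≠ some i} ≤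
      (channelLaw Q P).real Aᶜ + ((K : ℝ) - 1) * (Q.prod (channelLaw Q P).snd).real A by
    refine (mul_le_mul_of_nonneg_left (Finset.sum_le_sum fun i _ => h i) (by positivity)).trans ?_
    rw [Finset.sum_const, Finset.card_univ, Fintype.card_fin, nsmul_eq_mul, ← mul_assoc,
      one_div_mul_cancel hK0, one_mul]
  intro i
  have hsub : {ω : (Fin K → Vec n) × Vec n | typicalDecoder A ω.1 (ω.2 + ω.1 i) ≠ some i} ⊆
      (fun ω => (ω.1 i, ω.2 + ω.1 i)) ⁻¹' Aᶜ ∪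
      ⋃ j ∈ Finset.univ.erase i, (fun ω => (ω.1 j, ω.2 + ω.1 i)) ⁻¹' A := by
    intro ω hω
    by_contra hc
    simp only [Set.mem_union, Set.mem_preimage, Set.mem_compl_iff, Set.mem_iUnion,
      Finset.mem_erase, Finset.mem_univ, and_true, not_or, not_not, not_exists] at hc
    exact hω ((typicalDecoder_eq_some_iff A ω.1 _ i).mpr ⟨hc.1, hc.2⟩)
  refine (measureReal_mono hsub).trans ((measureReal_union_le _ _).trans (add_le_add ?_ ?_))
  · rw [← map_codeword_channel Q P i, map_measureReal_apply (by fun_prop) hA.compl]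
  · refine (measureReal_biUnion_finset_le _ _).trans (le_of_eq ?_)
    have h : ∀ j ∈ Finset.univ.erase i, M.real ((fun ω => (ω.1 j, ω.2 + ω.1 i)) ⁻¹' A) =
        (Q.prod (channelLaw Q P).snd).real A := fun j hj => by
      rw [← map_other_codeword_channel Q P (Finset.ne_of_mem_erase hj),
        map_measureReal_apply (by fun_prop) hA]
    rw [Finset.sum_congr rfl h, Finset.sum_const, Finset.card_erase_of_mem (Finset.mem_univ _),
      Finset.card_univ, Fintype.card_fin, nsmul_eq_mul, Nat.cast_sub hK, Nat.cast_one]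

/-- By Fubini the random code error is the mean of the codebook error, and some codebook does not
exceed the mean. -/
theorem exists_codebookError_le {n K : ℕ} {A : Set (Vec n × Vec n)}
    (hA : MeasurableSet A) (Q P : Measure (Vec n)) [IsProbabilityMeasure Q]
    [IsProbabilityMeasure P] :
    ∃ C : Fin K → Vec n, codebookError A P C ≤ randomCodeError K A Q P := by
  set M := Measure.pi fun _ : Fin K => Q
  let E : Fin K → Set ((Fin K → Vec n) × Vec n) :=
    fun i => {ω | typicalDecoder A ω.1 (ω.2 + ω.1 i) ≠ some i}
  have hE : ∀ i, MeasurableSet (E i) := measurableSet_decoder_error hA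
  have hint : ∀ i, Integrable (fun C => P.real (Prod.mk C ⁻¹' E i)) M := fun i =>
    Integrable.of_bound
      (measurable_measure_prodMk_left (hE i)).ennreal_toReal.aestronglyMeasurable 1
      (ae_of_all _ fun C => by
        rw [Real.norm_of_nonneg measureReal_nonneg]
        exact measureReal_le_one)
  have hsum : Integrable (codebookError A P (K := K)) M :=
    (integrable_finsetSum _ fun i _ => hint i).const_mul _
  obtain ⟨C, hC⟩ := exists_le_integral hsum
  refine ⟨C, hC.trans (le_of_eq ?_)⟩
  unfold codebookError randomCodeError
  rw [integral_const_mul]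
  congr 1
  refine (integral_finsetSum _ fun i _ => hint i).trans (Finset.sum_congr rfl fun i _ => ?_)
  change _ = (M.prod P).real (E i)
  rw [measureReal_def, Measure.prod_apply (hE i), integral_eq_lintegral_of_nonneg_ae
    (ae_of_all _ fun _ => measureReal_nonneg) (hint i).aestronglyMeasurable]
  simp only [measureReal_def, ENNReal.ofReal_toReal (measure_ne_top P _)]

/-! ### The embedding factor -/

/-- From `log (a/b) < a/b - 1 = (a - b)/b ≤ a - b`, where the last step needs `b ≥ 1`. -/
theorem sub_log_lt_sub_log {b a : ℝ} (hb : 1 ≤ b) (hab : b < a) :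
    b - Real.log b < a - Real.log a := by
  have hb0 : 0 < b := by linarith
  have ha0 : 0 < a := hb0.trans hab
  have h1 : Real.log (a / b) < a / b - 1 :=
    Real.log_lt_sub_one_of_pos (by positivity)
      (by rw [ne_eq, div_eq_one_iff_eq hb0.ne']; exact hab.ne')
  rw [Real.log_div ha0.ne' hb0.ne'] at h1
  have h2 : a / b - 1 ≤ a - b := by
    rw [div_sub_one hb0.ne']
    exact div_le_self (by linarith) hb
  linarith

theorem exists_sub_log_eq {x : ℝ} (hx : 0 < x) : ∃ a : ℝ, 1 < a ∧ a - Real.log a = 1 + x := by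
  -- The endpoint `2(1 + x)` is large enough because `log (2(1 + x)) ≤ log 2 + x < 1 + x`.
  have hB : (1 : ℝ) ≤ 2 * (1 + x) := by linarith
  have hc : ContinuousOn (fun t : ℝ => t - Real.log t) (Set.Icc 1 (2 * (1 + x))) :=
    continuousOn_id.sub (Real.continuousOn_log.mono fun t ht => by
      have := ht.1
      simp only [Set.mem_compl_iff, Set.mem_singleton_iff]
      linarith)
  have hlog : Real.log (2 * (1 + x)) ≤ 1 + x := by
    rw [Real.log_mul (by norm_num) (by linarith)]
    have := Real.log_le_sub_one_of_pos (show 0 < 1 + x by linarith)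
    have := Real.log_two_lt_d9
    linarith
  obtain ⟨a, ha, hfa⟩ := intermediate_value_Icc hB hc
    (show 1 + x ∈ Set.Icc _ _ by
      constructor
      · simp; linarith
      · linarith)
  refine ⟨a, lt_of_le_of_ne ha.1 ?_, hfa⟩
  rintro rfl
  simp at hfa
  linarith

theorem neg_mul_exp_neg_eq_iff {b x : ℝ} (hb : 1 ≤ b) :
    -b * Real.exp (-b) = -Real.exp (-x - 1) ↔ b - Real.log b = 1 + x := by
  have hb0 : 0 < b := by linarith
  rw [neg_mul, neg_inj]
  conv_lhs => lhs; rw [← Real.exp_log hb0, ← Real.exp_add, Real.exp_log hb0]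
  rw [Real.exp_eq_exp]
  constructor <;> intro h <;> linarith

/-- With `w = -b`, the Lambert equation becomes `b - log b = 1 + 4τ²/n`. Strict monotonicity on `[1,
∞)` makes the set in `lambertWNegOne` a singleton, so its infimum is the root. Later arguments use
only this characterization. -/
theorem embeddingFactor_spec {n : ℕ} (hn : 1 ≤ n) {τ : ℝ} (hτ : 0 < τ) :
    1 < embeddingFactor n τ ∧
      embeddingFactor n τ - Real.log (embeddingFactor n τ) = 1 + 4 * τ ^ 2 / n := by
  have hn' : (0 : ℝ) < n := by exact_mod_cast hn
  obtain ⟨a, ha, hfa⟩ := exists_sub_log_eq (show 0 < 4 * τ ^ 2 / n by positivity)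
  have hset : {w : ℝ | w ≤ -1 ∧ w * Real.exp w = -Real.exp (-(4 * τ ^ 2 / n) - 1)} = {-a} := by
    ext w
    simp only [Set.mem_ofPred_eq, Set.mem_singleton_iff]
    constructor
    · rintro ⟨hw, he⟩
      have hb : 1 ≤ -w := by linarith
      have h := (neg_mul_exp_neg_eq_iff (x := 4 * τ ^ 2 / n) hb).mp (by rwa [neg_neg])
      rcases lt_trichotomy (-w) a with hlt | heq | hgt
      · linarith [sub_log_lt_sub_log hb hlt]
      · linarith
      · linarith [sub_log_lt_sub_log ha.le hgt]
    · rintro rfl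
      exact ⟨by linarith, (neg_mul_exp_neg_eq_iff ha.le).mpr hfa⟩
  have : embeddingFactor n τ = a := by
    rw [embeddingFactor, wrightOmegaSubPiI, lambertWNegOne, hset, csInf_singleton, neg_neg]
  rw [this]
  exact ⟨ha, hfa⟩

theorem tendsto_embeddingFactor {τ : ℝ} (hτ : 0 < τ) :
    Filter.Tendsto (fun n : ℕ => embeddingFactor n τ) Filter.atTop (nhds 1) := by
  rw [Metric.tendsto_atTop]
  intro η hη
  have hg : 0 < 1 + η - Real.log (1 + η) - 1 := by
    have := sub_log_lt_sub_log le_rfl (show 1 < 1 + η by linarith)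
    simp at this
    linarith
  obtain ⟨N, hN⟩ := exists_nat_gt (4 * τ ^ 2 / (1 + η - Real.log (1 + η) - 1))
  refine ⟨max N 1, fun n hn => ?_⟩
  have hn1 : 1 ≤ n := (le_max_right _ _).trans hn
  have hn0 : (0 : ℝ) < n := by exact_mod_cast hn1
  obtain ⟨ha, he⟩ := embeddingFactor_spec hn1 hτ
  rw [Real.dist_eq, abs_of_pos (by linarith)]
  by_contra hc
  -- If `a` were at least `1 + η`, monotonicity would keep `a - log a` away from `1`, although it
  -- equals `1 + 4τ²/n`.
  have h1 : 1 + η - Real.log (1 + η) ≤ embeddingFactor n τ - Real.log (embeddingFactor n τ) := by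
    rcases (show 1 + η ≤ embeddingFactor n τ by linarith).eq_or_lt with h | h
    · rw [h]
    · exact (sub_log_lt_sub_log (by linarith) h).le
  have h2 : (N : ℝ) ≤ n := by exact_mod_cast (le_max_left _ _).trans hn
  have h3 := hN.trans_le h2
  rw [div_lt_iff₀ hg] at h3
  have h4 : 4 * τ ^ 2 / n < 1 + η - Real.log (1 + η) - 1 := by
    rw [div_lt_iff₀ hn0]
    linarith
  linarith

theorem precisionForm_smul {n : ℕ} {S : Matrix (Fin n) (Fin n) ℝ} (hS : S.PosDef) {a : ℝ}
    (ha : 0 < a) (x : Vec n) : precisionForm (a • S) x = precisionForm S x / a := by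
  have h : (a • S)⁻¹ = a⁻¹ • S⁻¹ := by
    refine Matrix.inv_eq_left_inv ?_
    rw [smul_mul_smul_comm, inv_mul_cancel₀ ha.ne', one_smul,
      Matrix.nonsing_inv_mul _ (isUnit_iff_ne_zero.mpr hS.det_pos.ne')]
  rw [precisionForm, h, smul_mulVec, dotProduct_smul, smul_eq_mul, precisionForm]
  ring

/-! ### Laws on the channel and the information density -/

section channel

variable {n : ℕ} (Q P : Measure (Vec n))

theorem measurePreserving_channel_message [IsProbabilityMeasure P] :
    MeasurePreserving Prod.fst (channelLaw Q P) Q := by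
  refine ⟨by fun_prop, ?_⟩
  rw [channelLaw, Measure.map_map (by fun_prop) (by fun_prop)]
  exact measurePreserving_fst.map_eq

theorem measurePreserving_channel_cover [IsProbabilityMeasure Q] [SFinite P] :
    MeasurePreserving (fun p => p.2 - p.1) (channelLaw Q P) P := by
  refine ⟨by fun_prop, ?_⟩
  rw [channelLaw, Measure.map_map (by fun_prop) (by fun_prop)]
  have : (fun p : Vec n × Vec n => p.2 - p.1) ∘ (fun p => (p.1, p.2 + p.1)) = Prod.snd := by
    ext p : 1
    simp
  rw [this]
  exact measurePreserving_snd.map_eq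

theorem snd_channelLaw [SFinite Q] [SFinite P] : (channelLaw Q P).snd = P ∗ Q := by
  rw [Measure.snd, channelLaw, Measure.map_map (by fun_prop) (by fun_prop), Measure.conv,
    ← Measure.prod_swap, Measure.map_map (by fun_prop) (by fun_prop)]
  rfl

end channel

section stego

variable {n : ℕ} {τ : ℝ} (μ : Vec n) {S : Matrix (Fin n) (Fin n) ℝ}

instance : IsProbabilityMeasure (messageLaw τ S) :=
  inferInstanceAs (IsProbabilityMeasure (multivariateGaussian _ _))

instance : IsProbabilityMeasure (coverLaw μ S) :=
  inferInstanceAs (IsProbabilityMeasure (multivariateGaussian _ _))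

theorem messageStegoLaw_eq : messageStegoLaw τ μ S = channelLaw (messageLaw τ S) (coverLaw μ S) :=
  rfl

instance : IsProbabilityMeasure (messageStegoLaw τ μ S) :=
  inferInstanceAs (IsProbabilityMeasure (channelLaw _ _))

theorem snd_messageStegoLaw (ha : 1 < embeddingFactor n τ) (hS : S.PosDef) :
    (messageStegoLaw τ μ S).snd = multivariateGaussian μ (embeddingFactor n τ • S) := by
  rw [messageStegoLaw_eq, snd_channelLaw, coverLaw, messageLaw,
    multivariateGaussian_conv _ _ hS.posSemidef (hS.posSemidef.smul (by linarith)), add_zero]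
  congr 1
  module

theorem measurePreserving_stego (ha : 1 < embeddingFactor n τ) (hS : S.PosDef) :
    MeasurePreserving Prod.snd (messageStegoLaw τ μ S)
      (multivariateGaussian μ (embeddingFactor n τ • S)) :=
  ⟨by fun_prop, snd_messageStegoLaw μ ha hS⟩

theorem measurable_messageStegoDensity : Measurable (messageStegoDensity τ μ S) := by
  unfold messageStegoDensity messageDensity
  fun_prop

theorem messageStegoLaw_eq_withDensity (ha : 1 < embeddingFactor n τ) (hS : S.PosDef) :
    messageStegoLaw τ μ S =
      volume.withDensity (fun p => ENNReal.ofReal (messageStegoDensity τ μ S p)) := by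
  have hm : ((embeddingFactor n τ - 1) • S).PosDef := hS.smul (by linarith)
  have hM : Measurable fun p => ENNReal.ofReal (messageStegoDensity τ μ S p) :=
    (measurable_messageStegoDensity μ).ennreal_ofReal
  rw [messageStegoLaw, messageLaw, coverLaw, multivariateGaussian_eq_withDensity _ hm,
    multivariateGaussian_eq_withDensity _ hS, prod_withDensity (by fun_prop) (by fun_prop)]
  have e : (fun p : Vec n × Vec n => ENNReal.ofReal (gaussianDensity 0
      ((embeddingFactor n τ - 1) • S) p.1) * ENNReal.ofReal (gaussianDensity μ S p.2)) =
      (fun p => ENNReal.ofReal (messageStegoDensity τ μ S p)) ∘ fun p => (p.1, p.2 + p.1) := by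
    ext p
    rw [Function.comp_apply, messageStegoDensity, messageDensity, add_sub_cancel_right,
      ENNReal.ofReal_mul (gaussianDensity_pos _ hm _).le]
  rw [e, map_withDensity_comp _ (by fun_prop) hM,
    (measurePreserving_prod_add_right volume volume).map_eq]
  rfl

theorem infoDensity_eq (ha : 1 < embeddingFactor n τ) (hS : S.PosDef) (p : Vec n × Vec n) :
    infoDensity τ μ S p = n / 2 * Real.log (embeddingFactor n τ) +
      precisionForm (embeddingFactor n τ • S) (p.2 - μ) / 2 -
      precisionForm S (p.2 - p.1 - μ) / 2 := by
  have hm : ((embeddingFactor n τ - 1) • S).PosDef := hS.smul (by linarith)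
  have hs : (embeddingFactor n τ • S).PosDef := hS.smul (by linarith)
  have h1 := gaussianDensity_pos 0 hm p.1
  have h2 := gaussianDensity_pos μ hs p.2
  have h3 := gaussianDensity_pos μ hS (p.2 - p.1)
  have h4 := hS.det_pos
  have h5 := Real.pi_pos
  rw [infoDensity, messageStegoDensity, messageDensity, stegoDensity,
    mul_div_mul_left _ _ h1.ne', Real.log_div h3.ne' h2.ne', log_gaussianDensity _ hS,
    log_gaussianDensity _ hs, det_smul, Fintype.card_fin,
    mul_left_comm, Real.log_mul (by positivity) (by positivity) (x := embeddingFactor n τ ^ n),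
    Real.log_pow]
  ring

theorem exp_infoDensity (ha : 1 < embeddingFactor n τ) (hS : S.PosDef) (p : Vec n × Vec n) :
    messageDensity τ S p.1 * stegoDensity τ μ S p.2 * Real.exp (infoDensity τ μ S p) =
      messageStegoDensity τ μ S p := by
  have hm : ((embeddingFactor n τ - 1) • S).PosDef := hS.smul (by linarith)
  have hs : (embeddingFactor n τ • S).PosDef := hS.smul (by linarith)
  have h1 : 0 < messageDensity τ S p.1 := gaussianDensity_pos 0 hm p.1
  have h2 : 0 < stegoDensity τ μ S p.2 := gaussianDensity_pos μ hs p.2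
  have h3 := gaussianDensity_pos μ hS (p.2 - p.1)
  have h4 : 0 < messageStegoDensity τ μ S p := mul_pos h1 h3
  rw [infoDensity, Real.exp_log (by positivity)]
  field_simp

theorem measurable_infoDensity (ha : 1 < embeddingFactor n τ) (hS : S.PosDef) :
    Measurable (infoDensity τ μ S) := by
  rw [funext (infoDensity_eq μ ha hS)]
  fun_prop

/-- The change of measure behind both the mutual information formula and the bound for independent
pairs. -/
theorem messageStegoLaw_eq_withDensity_exp (ha : 1 < embeddingFactor n τ) (hS : S.PosDef) :
    messageStegoLaw τ μ S = ((messageLaw τ S).prod (messageStegoLaw τ μ S).snd).withDensity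
      (fun p => ENNReal.ofReal (Real.exp (infoDensity τ μ S p))) := by
  have hm : ((embeddingFactor n τ - 1) • S).PosDef := hS.smul (by linarith)
  have hs : (embeddingFactor n τ • S).PosDef := hS.smul (by linarith)
  have hi := (measurable_infoDensity μ ha hS).exp.ennreal_ofReal
  rw [snd_messageStegoLaw μ ha hS, messageStegoLaw_eq_withDensity μ ha hS, messageLaw,
    multivariateGaussian_eq_withDensity _ hm,
    multivariateGaussian_eq_withDensity _ hs, prod_withDensity (by fun_prop) (by fun_prop),
    ← withDensity_mul _ (by fun_prop) hi]
  congr 1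
  ext p
  rw [← exp_infoDensity μ ha hS, Pi.mul_apply, messageDensity, stegoDensity,
    ENNReal.ofReal_mul (mul_pos (gaussianDensity_pos _ hm _) (gaussianDensity_pos _ hs _)).le,
    ENNReal.ofReal_mul (gaussianDensity_pos _ hm _).le]

theorem integrable_infoDensity (ha : 1 < embeddingFactor n τ) (hS : S.PosDef) :
    Integrable (infoDensity τ μ S) (messageStegoLaw τ μ S) ∧
      ∫ p, infoDensity τ μ S p ∂(messageStegoLaw τ μ S) =
        n / 2 * Real.log (embeddingFactor n τ) := by
  have hs : (embeddingFactor n τ • S).PosDef := hS.smul (by linarith)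
  have m1 := measurePreserving_stego μ ha hS
  have m2 := measurePreserving_channel_cover (messageLaw τ S) (coverLaw μ S)
  have i1 : Integrable (fun p : Vec n × Vec n =>
      precisionForm (embeddingFactor n τ • S) (p.2 - μ)) (messageStegoLaw τ μ S) :=
    m1.integrable_comp_of_integrable (integrable_precisionForm μ hs)
  have i2 : Integrable (fun p : Vec n × Vec n =>
      precisionForm S (p.2 - p.1 - μ)) (messageStegoLaw τ μ S) :=
    m2.integrable_comp_of_integrable (integrable_precisionForm μ hS)
  have e1 : ∫ p, precisionForm (embeddingFactor n τ • S) (p.2 - μ) ∂(messageStegoLaw τ μ S) = n := by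
    rw [← integral_precisionForm μ hs, ← m1.map_eq, integral_map (by fun_prop)
      (Measurable.aestronglyMeasurable (by fun_prop))]
  have e2 : ∫ p, precisionForm S (p.2 - p.1 - μ) ∂(messageStegoLaw τ μ S) = n := by
    have h := integral_precisionForm μ hS
    change ∫ x, precisionForm S (x - μ) ∂(coverLaw μ S) = n at h
    rw [← h, ← m2.map_eq, integral_map (by fun_prop)
      (Measurable.aestronglyMeasurable (by fun_prop))]
    rfl
  rw [funext (infoDensity_eq μ ha hS)]
  refine ⟨((integrable_const _).add (i1.div_const 2)).sub (i2.div_const 2), ?_⟩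
  beta_reduce
  rw [integral_sub (f := fun p : Vec n × Vec n => n / 2 * Real.log (embeddingFactor n τ) +
      precisionForm (embeddingFactor n τ • S) (p.2 - μ) / 2) ((integrable_const _).add (i1.div_const 2)) (i2.div_const 2),
    integral_add (integrable_const _) (i1.div_const 2), integral_div, integral_div, e1, e2]
  simp

theorem stegoInfo_eq (ha : 1 < embeddingFactor n τ) (hS : S.PosDef) :
    stegoInfo τ μ S = ENNReal.ofReal (n / 2 * Real.log (embeddingFactor n τ)) := by
  obtain ⟨hint, hval⟩ := integrable_infoDensity μ ha hS
  have hρ := messageStegoLaw_eq_withDensity_exp μ ha hS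
  have hfst : (messageStegoLaw τ μ S).fst = messageLaw τ S :=
    (measurePreserving_channel_message (messageLaw τ S) (coverLaw μ S)).map_eq
  have hac : messageStegoLaw τ μ S ≪ (messageLaw τ S).prod (messageStegoLaw τ μ S).snd := by
    conv_lhs => rw [hρ]
    exact withDensity_absolutelyContinuous _ _
  have hrn : (messageStegoLaw τ μ S).rnDeriv ((messageLaw τ S).prod (messageStegoLaw τ μ S).snd)
      =ᵐ[(messageLaw τ S).prod (messageStegoLaw τ μ S).snd]
      fun p => ENNReal.ofReal (Real.exp (infoDensity τ μ S p)) := by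
    have h := Measure.rnDeriv_withDensity ((messageLaw τ S).prod (messageStegoLaw τ μ S).snd)
      (measurable_infoDensity μ ha hS).exp.ennreal_ofReal
    rwa [← hρ] at h
  have hllr : llr (messageStegoLaw τ μ S) ((messageLaw τ S).prod (messageStegoLaw τ μ S).snd)
      =ᵐ[messageStegoLaw τ μ S] infoDensity τ μ S := by
    filter_upwards [hac hrn] with p hp
    rw [llr, hp, ENNReal.toReal_ofReal (Real.exp_pos _).le, Real.log_exp]
  -- The log-likelihood ratio is the information density almost everywhere; the mass terms in
  -- `klDiv` cancel between probability measures.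
  rw [stegoInfo, mutualInfo, hfst,
    InformationTheory.klDiv_of_ac_of_integrable hac (hint.congr hllr.symm),
    integral_congr_ae hllr, hval]
  simp

theorem stegoInfo_toReal (ha : 1 < embeddingFactor n τ) (hS : S.PosDef) :
    (stegoInfo τ μ S).toReal = n / 2 * Real.log (embeddingFactor n τ) := by
  rw [stegoInfo_eq μ ha hS, ENNReal.toReal_ofReal]
  have := Real.log_pos ha
  positivity

/-- Independent pairs rarely have large information density. -/
theorem independent_measure_le (ha : 1 < embeddingFactor n τ) (hS : S.PosDef)
    {A : Set (Vec n × Vec n)} (hA : MeasurableSet A) {t : ℝ}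
    (ht : ∀ p ∈ A, t ≤ infoDensity τ μ S p) :
    ((messageLaw τ S).prod (messageStegoLaw τ μ S).snd).real A ≤ Real.exp (-t) := by
  set ν := (messageLaw τ S).prod (messageStegoLaw τ μ S).snd with hν
  have h1 : ENNReal.ofReal (Real.exp t) * ν A ≤ messageStegoLaw τ μ S A := by
    rw [messageStegoLaw_eq_withDensity_exp μ ha hS, ← hν, withDensity_apply _ hA,
      ← setLIntegral_const]
    exact setLIntegral_mono' hA fun p hp =>
      ENNReal.ofReal_le_ofReal (Real.exp_le_exp.mpr (ht p hp))
  have h2 := ENNReal.toReal_mono ENNReal.one_ne_top (h1.trans prob_le_one)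
  rw [ENNReal.toReal_mul, ENNReal.toReal_ofReal (Real.exp_pos _).le, ENNReal.toReal_one] at h2
  rw [Real.exp_neg, ← one_div, le_div_iff₀ (Real.exp_pos _), mul_comm]
  exact h2

end stego

/-! ### Typicality as conditions on quadratic forms -/

theorem isTypical_gaussianDensity_iff {n : ℕ} (hn : 1 ≤ n) (γ : ℝ) (μ : Vec n)
    {S : Matrix (Fin n) (Fin n) ℝ} (hS : S.PosDef) (x : Vec n) :
    IsTypical n γ (gaussianDensity μ S) x ↔ |precisionForm S (x - μ) - n| < 2 * γ * n := by
  have hn' : (0 : ℝ) < n := by exact_mod_cast hn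
  rw [IsTypical, log_gaussianDensity μ hS, differentialEntropy_gaussianDensity μ hS]
  have e : ∀ l q : ℝ, -(1 / (n : ℝ)) * (-(l / 2) - q / 2) - (l / 2 + n / 2) / n =
      (q - n) / (2 * n) := fun l q => by
    field_simp
    ring
  rw [e, abs_div, abs_of_pos (show (0 : ℝ) < 2 * n by positivity), div_lt_iff₀ (by positivity)]
  rw [show γ * (2 * (n : ℝ)) = 2 * γ * n by ring]

section stego

variable {n : ℕ} {τ : ℝ} (μ : Vec n) {S : Matrix (Fin n) (Fin n) ℝ}

theorem log_messageStegoDensity (ha : 1 < embeddingFactor n τ) (hS : S.PosDef)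
    (p : Vec n × Vec n) : Real.log (messageStegoDensity τ μ S p) =
      Real.log (messageDensity τ S p.1) + Real.log (gaussianDensity μ S (p.2 - p.1)) :=
  Real.log_mul (gaussianDensity_pos 0 (hS.smul (sub_pos.mpr ha)) _).ne'
    (gaussianDensity_pos μ hS _).ne'

theorem integrable_log_gaussianDensity (hS : S.PosDef) :
    Integrable (fun x => Real.log (gaussianDensity μ S x)) (multivariateGaussian μ S) := by
  simp_rw [log_gaussianDensity μ hS]
  exact (integrable_const _).sub ((integrable_precisionForm μ hS).div_const _)

/-- The joint density is a product in the independent variables `m` and `s - m`, so its logarithm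
splits and each part integrates against its own marginal. -/
theorem differentialEntropy_messageStegoDensity (ha : 1 < embeddingFactor n τ) (hS : S.PosDef) :
    differentialEntropy (messageStegoDensity τ μ S) =
      differentialEntropy (messageDensity τ S) + differentialEntropy (gaussianDensity μ S) := by
  have hm : ((embeddingFactor n τ - 1) • S).PosDef := hS.smul (by linarith)
  have m1 : MeasurePreserving Prod.fst (messageStegoLaw τ μ S)
      (multivariateGaussian 0 ((embeddingFactor n τ - 1) • S)) :=
    measurePreserving_channel_message (messageLaw τ S) (coverLaw μ S)
  have m2 : MeasurePreserving (fun p => p.2 - p.1) (messageStegoLaw τ μ S)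
      (multivariateGaussian μ S) :=
    measurePreserving_channel_cover (messageLaw τ S) (coverLaw μ S)
  have j1 := integrable_log_gaussianDensity 0 hm
  have j2 := integrable_log_gaussianDensity μ hS
  rw [differentialEntropy_eq_of_withDensity (measurable_messageStegoDensity μ)
    (fun p => (mul_pos (gaussianDensity_pos 0 hm _) (gaussianDensity_pos μ hS _)).le)
    (messageStegoLaw_eq_withDensity μ ha hS), messageDensity,
    differentialEntropy_eq_of_withDensity (by fun_prop) (fun x => (gaussianDensity_pos 0 hm x).le)
      (multivariateGaussian_eq_withDensity 0 hm),
    differentialEntropy_eq_of_withDensity (by fun_prop) (fun x => (gaussianDensity_pos μ hS x).le)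
      (multivariateGaussian_eq_withDensity μ hS)]
  simp_rw [log_messageStegoDensity μ ha hS]
  have k1 : Integrable (fun p : Vec n × Vec n => Real.log (gaussianDensity 0
      ((embeddingFactor n τ - 1) • S) p.1)) (messageStegoLaw τ μ S) :=
    m1.integrable_comp_of_integrable j1
  have k2 : Integrable (fun p : Vec n × Vec n => Real.log (gaussianDensity μ S (p.2 - p.1)))
      (messageStegoLaw τ μ S) := m2.integrable_comp_of_integrable j2
  rw [messageDensity, integral_add k1 k2, neg_add]
  congr 2
  · rw [← m1.map_eq, integral_map (by fun_prop) (Measurable.aestronglyMeasurable (by fun_prop))]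
  · rw [← m2.map_eq, integral_map (by fun_prop) (Measurable.aestronglyMeasurable (by fun_prop))]

theorem isTypical_messageStegoDensity_iff (hn : 1 ≤ n) (γ : ℝ) (ha : 1 < embeddingFactor n τ)
    (hS : S.PosDef) (p : Vec n × Vec n) :
    IsTypical n γ (messageStegoDensity τ μ S) p ↔
      |precisionForm ((embeddingFactor n τ - 1) • S) p.1 - n +
        (precisionForm S (p.2 - p.1 - μ) - n)| < 2 * γ * n := by
  have hm : ((embeddingFactor n τ - 1) • S).PosDef := hS.smul (by linarith)
  have hn' : (0 : ℝ) < n := by exact_mod_cast hn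
  rw [IsTypical, log_messageStegoDensity μ ha hS, differentialEntropy_messageStegoDensity μ ha hS,
    messageDensity, log_gaussianDensity μ hS, log_gaussianDensity 0 hm,
    differentialEntropy_gaussianDensity μ hS, differentialEntropy_gaussianDensity 0 hm, sub_zero]
  have e : ∀ l q l' q' : ℝ, -(1 / (n : ℝ)) * (-(l / 2) - q / 2 + (-(l' / 2) - q' / 2)) -
      (l / 2 + n / 2 + (l' / 2 + n / 2)) / n = (q - n + (q' - n)) / (2 * n) := fun l q l' q' => by
    field_simp
    ring
  rw [e, abs_div, abs_of_pos (show (0 : ℝ) < 2 * n by positivity), div_lt_iff₀ (by positivity)]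
  rw [show γ * (2 * (n : ℝ)) = 2 * γ * n by ring]

theorem mem_jointlyTypicalSet_iff (hn : 1 ≤ n) (γ : ℝ) (ha : 1 < embeddingFactor n τ)
    (hS : S.PosDef) (p : Vec n × Vec n) :
    p ∈ jointlyTypicalSet γ τ μ S ↔
      |precisionForm ((embeddingFactor n τ - 1) • S) p.1 - n| < 2 * γ * n ∧
      |precisionForm (embeddingFactor n τ • S) (p.2 - μ) - n| < 2 * γ * n ∧
      |precisionForm ((embeddingFactor n τ - 1) • S) p.1 - n +
        (precisionForm S (p.2 - p.1 - μ) - n)| < 2 * γ * n := by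
  rw [jointlyTypicalSet, Set.mem_ofPred_eq, isTypical_messageStegoDensity_iff μ hn γ ha hS,
    messageDensity, stegoDensity,
    isTypical_gaussianDensity_iff hn γ 0 (hS.smul (sub_pos.mpr ha)),
    isTypical_gaussianDensity_iff hn γ μ (hS.smul (by linarith)), sub_zero]

theorem measurableSet_jointlyTypicalSet (hn : 1 ≤ n) (γ : ℝ) (ha : 1 < embeddingFactor n τ)
    (hS : S.PosDef) : MeasurableSet (jointlyTypicalSet γ τ μ S) := by
  have h (f : Vec n × Vec n → ℝ) (hf : Measurable f) : MeasurableSet {p | |f p| < 2 * γ * n} :=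
    measurableSet_lt hf.abs measurable_const
  refine (MeasurableSet.congr · (Set.ext (mem_jointlyTypicalSet_iff μ hn γ ha hS)).symm) ?_
  exact (h _ (by fun_prop)).inter ((h _ (by fun_prop)).inter (h _ (by fun_prop)))

theorem measurableSet_refinedTypicalSet (hn : 1 ≤ n) (γ t : ℝ) (ha : 1 < embeddingFactor n τ)
    (hS : S.PosDef) : MeasurableSet (refinedTypicalSet γ t τ μ S) :=
  (measurableSet_jointlyTypicalSet μ hn γ ha hS).inter
    (measurableSet_lt ((measurable_infoDensity μ ha hS).sub_const _).abs measurable_const)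

/-- The deviation of the information density is half of (stego) minus (joint) plus (message)
deviation, each smaller than `2γn` in absolute value. -/
theorem infoDensity_ge_of_mem_jointlyTypicalSet (hn : 1 ≤ n) {γ : ℝ}
    (ha : 1 < embeddingFactor n τ) (hS : S.PosDef) {p : Vec n × Vec n}
    (hp : p ∈ jointlyTypicalSet γ τ μ S) :
    n / 2 * Real.log (embeddingFactor n τ) - 3 * γ * n ≤ infoDensity τ μ S p := by
  obtain ⟨h1, h2, h3⟩ := (mem_jointlyTypicalSet_iff μ hn γ ha hS p).mp hp
  rw [abs_lt] at h1 h2 h3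
  rw [infoDensity_eq μ ha hS]
  linarith

theorem real_precisionForm_sub_ge_le {Ω : Type*} [MeasurableSpace Ω] {ρ : Measure Ω}
    [IsFiniteMeasure ρ] {X : Ω → Vec n} (ν : Vec n) {T : Matrix (Fin n) (Fin n) ℝ}
    (hT : T.PosDef) (hX : MeasurePreserving X ρ (multivariateGaussian ν T)) {t : ℝ} (ht : 0 < t) :
    ρ.real {ω | t ≤ |precisionForm T (X ω - ν) - n|} ≤ n * chiSqVariance / t ^ 2 := by
  have h := measure_precisionForm_sub_ge_le ν hT ht
  rw [← hX.map_eq, Measure.map_apply hX.measurable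
    (measurableSet_le (by fun_prop) (by fun_prop))] at h
  have hv := chiSqVariance_nonneg
  exact ENNReal.toReal_le_of_le_ofReal (by positivity) h

theorem atypical_le (hn : 1 ≤ n) {γ : ℝ} (hγ : 0 < γ) (ha : 1 < embeddingFactor n τ)
    (hS : S.PosDef) :
    (messageStegoLaw τ μ S).real (jointlyTypicalSet γ τ μ S)ᶜ ≤
      3 * chiSqVariance / γ ^ 2 / n := by
  have hn' : (0 : ℝ) < n := by exact_mod_cast hn
  -- Radius `γn` rather than `2γn`: the joint condition adds the deviations of two forms.
  have hγn : 0 < γ * n := by positivity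
  have hm : ((embeddingFactor n τ - 1) • S).PosDef := hS.smul (by linarith)
  have hs : (embeddingFactor n τ • S).PosDef := hS.smul (by linarith)
  have b1 := real_precisionForm_sub_ge_le 0 hm
    (measurePreserving_channel_message (messageLaw τ S) (coverLaw μ S)) hγn
  have b2 := real_precisionForm_sub_ge_le μ hS
    (measurePreserving_channel_cover (messageLaw τ S) (coverLaw μ S)) hγn
  have b3 := real_precisionForm_sub_ge_le μ hs (measurePreserving_stego μ ha hS) hγn
  rw [← messageStegoLaw_eq] at b1 b2
  have hsub : (jointlyTypicalSet γ τ μ S)ᶜ ⊆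
      ({p | γ * n ≤ |precisionForm ((embeddingFactor n τ - 1) • S) (p.1 - 0) - n|} ∪
        {p | γ * n ≤ |precisionForm S (p.2 - p.1 - μ) - n|}) ∪
        {p | γ * n ≤ |precisionForm (embeddingFactor n τ • S) (p.2 - μ) - n|} := by
    intro p hp
    by_contra hc
    simp only [Set.mem_union, Set.mem_ofPred_eq, not_or, not_le, sub_zero] at hc
    refine hp ((mem_jointlyTypicalSet_iff μ hn γ ha hS p).mpr ⟨?_, ?_, ?_⟩)
    · linarith [hc.1.1]
    · linarith [hc.2]
    · linarith [hc.1.1, hc.1.2, abs_add_le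
        (precisionForm ((embeddingFactor n τ - 1) • S) p.1 - n)
        (precisionForm S (p.2 - p.1 - μ) - n)]
  have h := (measureReal_mono (μ := messageStegoLaw τ μ S) hsub).trans
    ((measureReal_union_le _ _).trans (add_le_add_left (measureReal_union_le _ _) _))
  have e : 3 * chiSqVariance / γ ^ 2 / n = 3 * (n * chiSqVariance / (γ * n) ^ 2) := by
    field_simp
  linarith

/-! ### Deviations of the information density at scale `√n` -/

theorem precisionForm_add (hS : S.PosDef) (x y : Vec n) :
    precisionForm S (x + y) = precisionForm S x + precisionForm S y +
      2 * ((S⁻¹ *ᵥ x.ofLp) ⬝ᵥ y.ofLp) := by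
  have hT : (S⁻¹)ᵀ = S⁻¹ := by
    have := hS.inv.isHermitian
    simpa [IsHermitian, conjTranspose_eq_transpose_of_trivial] using this
  have h1 : x.ofLp ⬝ᵥ S⁻¹ *ᵥ y.ofLp = (S⁻¹ *ᵥ x.ofLp) ⬝ᵥ y.ofLp := by
    rw [dotProduct_mulVec, ← mulVec_transpose, hT]
  have h2 : y.ofLp ⬝ᵥ S⁻¹ *ᵥ x.ofLp = (S⁻¹ *ᵥ x.ofLp) ⬝ᵥ y.ofLp := dotProduct_comm _ _
  simp only [precisionForm, WithLp.ofLp_add, mulVec_add, dotProduct_add, add_dotProduct, h1, h2]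
  ring

/-- Given the cover `c`, the cross term is centred Gaussian in `m` with variance `(a - 1) Q_S(c -
μ)`. Averaging over `c` gives second moment `(a - 1) n`, and Markov's inequality for the square
concludes. -/
theorem cross_term_le (ha : 1 < embeddingFactor n τ) (hS : S.PosDef) {t : ℝ} (ht : 0 < t) :
    (messageStegoLaw τ μ S).real
      {p | t ≤ |(S⁻¹ *ᵥ (p.2 - p.1 - μ).ofLp) ⬝ᵥ p.1.ofLp|} ≤
      (embeddingFactor n τ - 1) * n / t ^ 2 := by
  have ha' : 0 < embeddingFactor n τ - 1 := by linarith
  have hmeas : Measurable fun p : Vec n × Vec n =>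
      ENNReal.ofReal (((S⁻¹ *ᵥ (p.2 - p.1 - μ).ofLp) ⬝ᵥ p.1.ofLp) ^ 2) :=
    (Continuous.measurable (by fun_prop)).ennreal_ofReal
  have hmeas' : Measurable fun p : Vec n × Vec n =>
      ENNReal.ofReal (((S⁻¹ *ᵥ (p.2 - μ).ofLp) ⬝ᵥ p.1.ofLp) ^ 2) :=
    (Continuous.measurable (by fun_prop)).ennreal_ofReal
  have hinner : ∀ c : Vec n,
      ∫⁻ m : Vec n, ENNReal.ofReal (((S⁻¹ *ᵥ (c - μ).ofLp) ⬝ᵥ m.ofLp) ^ 2) ∂(messageLaw τ S) =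
        ENNReal.ofReal ((embeddingFactor n τ - 1) * precisionForm S (c - μ)) := fun c => by
    rw [messageLaw,
      lintegral_dotProduct_sq_multivariateGaussian (hS.smul ha').posSemidef, smul_mulVec,
      dotProduct_smul, smul_eq_mul, mulVec_mulVec,
      Matrix.mul_nonsing_inv _ (isUnit_iff_ne_zero.mpr hS.det_pos.ne'), one_mulVec,
      dotProduct_comm, precisionForm]
  have hQ0 : ∀ x : Vec n, 0 ≤ precisionForm S x := fun x => by
    simpa [precisionForm] using hS.inv.posSemidef.dotProduct_mulVec_nonneg x.ofLp
  have hint : ∫⁻ p, ENNReal.ofReal (((S⁻¹ *ᵥ (p.2 - p.1 - μ).ofLp) ⬝ᵥ p.1.ofLp) ^ 2)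
      ∂(messageStegoLaw τ μ S) = ENNReal.ofReal ((embeddingFactor n τ - 1) * n) := by
    rw [messageStegoLaw, lintegral_map hmeas (by fun_prop)]
    simp only [add_sub_cancel_right]
    rw [lintegral_prod_symm _ hmeas'.aemeasurable]
    simp only [hinner]
    rw [← integral_precisionForm μ hS, coverLaw, ← integral_const_mul,
      ofReal_integral_eq_lintegral_ofReal ((integrable_precisionForm μ hS).const_mul _)
      (ae_of_all _ fun x => mul_nonneg ha'.le (hQ0 _))]
  have hsub : {p : Vec n × Vec n | t ≤ |(S⁻¹ *ᵥ (p.2 - p.1 - μ).ofLp) ⬝ᵥ p.1.ofLp|} ⊆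
      {p | ENNReal.ofReal (t ^ 2) ≤
        ENNReal.ofReal (((S⁻¹ *ᵥ (p.2 - p.1 - μ).ofLp) ⬝ᵥ p.1.ofLp) ^ 2)} := fun p hp =>
    ENNReal.ofReal_le_ofReal (by
      rw [← sq_abs ((S⁻¹ *ᵥ (p.2 - p.1 - μ).ofLp) ⬝ᵥ p.1.ofLp)]
      exact pow_le_pow_left₀ ht.le hp 2)
  refine ENNReal.toReal_le_of_le_ofReal (by positivity) ((measure_mono hsub).trans ?_)
  rw [ENNReal.ofReal_div_of_pos (by positivity), ← hint]
  exact meas_ge_le_lintegral_div hmeas.aemeasurable (by simp; positivity) (by simp)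

/-- Expanding `Q_S` at `(s - m - μ) + m` nearly cancels the cover terms: what remains is a multiple
of `a - 1` and the cross term, divided by `a > 1`. This smallness in `a - 1` is what the `√n` regime
needs. -/
theorem abs_infoDensity_sub_le (ha : 1 < embeddingFactor n τ) (hS : S.PosDef)
    (p : Vec n × Vec n) :
    |infoDensity τ μ S p - n / 2 * Real.log (embeddingFactor n τ)| ≤
      (embeddingFactor n τ - 1) / 2 *
        (|precisionForm ((embeddingFactor n τ - 1) • S) p.1 - n| +
          |precisionForm S (p.2 - p.1 - μ) - n|) +
      |(S⁻¹ *ᵥ (p.2 - p.1 - μ).ofLp) ⬝ᵥ p.1.ofLp| := by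
  have ha' : 0 < embeddingFactor n τ - 1 := by linarith
  have ha0 : 0 < embeddingFactor n τ := by linarith
  have e1 : p.2 - μ = (p.2 - p.1 - μ) + p.1 := by abel
  have e2 : precisionForm S p.1 =
      (embeddingFactor n τ - 1) * precisionForm ((embeddingFactor n τ - 1) • S) p.1 := by
    rw [precisionForm_smul hS ha']
    field_simp
  rw [infoDensity_eq μ ha hS, precisionForm_smul hS ha0, e1, precisionForm_add hS, e2]
  generalize precisionForm ((embeddingFactor n τ - 1) • S) p.1 = q
  generalize precisionForm S (p.2 - p.1 - μ) = r
  generalize (S⁻¹ *ᵥ (p.2 - p.1 - μ).ofLp) ⬝ᵥ p.1.ofLp = w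
  generalize embeddingFactor n τ = a at *
  have e3 : n / 2 * Real.log a + (r + (a - 1) * q + 2 * w) / a / 2 - r / 2 -
      n / 2 * Real.log a = ((a - 1) / 2 * ((q - n) - (r - n)) + w) / a := by
    field_simp
    ring
  rw [e3, abs_div, abs_of_pos ha0]
  refine (div_le_self (abs_nonneg _) ha.le).trans ((abs_add_le _ _).trans ?_)
  rw [abs_mul, abs_of_pos (half_pos ha')]
  gcongr
  exact abs_sub _ _

theorem infoDensity_deviation_le (ha : 1 < embeddingFactor n τ) (hS : S.PosDef) {t : ℝ}
    (ht : 0 < t) :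
    (messageStegoLaw τ μ S).real
      {p | t ≤ |infoDensity τ μ S p - n / 2 * Real.log (embeddingFactor n τ)|} ≤
      (8 * chiSqVariance * (embeddingFactor n τ - 1) ^ 2 + 4 * (embeddingFactor n τ - 1)) *
        n / t ^ 2 := by
  have ha' : 0 < embeddingFactor n τ - 1 := by linarith
  have hm : ((embeddingFactor n τ - 1) • S).PosDef := hS.smul ha'
  -- Thresholds chosen so that the two quadratic forms together contribute `t/2`, leaving `t/2` for
  -- the cross term.
  have ht' : 0 < t / (2 * (embeddingFactor n τ - 1)) := by positivity
  have b1 := real_precisionForm_sub_ge_le 0 hm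
    (measurePreserving_channel_message (messageLaw τ S) (coverLaw μ S)) ht'
  have b2 := real_precisionForm_sub_ge_le μ hS
    (measurePreserving_channel_cover (messageLaw τ S) (coverLaw μ S)) ht'
  rw [← messageStegoLaw_eq] at b1 b2
  have b3 := cross_term_le μ ha hS (half_pos ht)
  have hsub : {p | t ≤ |infoDensity τ μ S p - n / 2 * Real.log (embeddingFactor n τ)|} ⊆
      ({p | t / (2 * (embeddingFactor n τ - 1)) ≤
          |precisionForm ((embeddingFactor n τ - 1) • S) (p.1 - 0) - n|} ∪
        {p | t / (2 * (embeddingFactor n τ - 1)) ≤ |precisionForm S (p.2 - p.1 - μ) - n|}) ∪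
        {p | t / 2 ≤ |(S⁻¹ *ᵥ (p.2 - p.1 - μ).ofLp) ⬝ᵥ p.1.ofLp|} := by
    intro p hp
    by_contra hc
    simp only [Set.mem_union, Set.mem_ofPred_eq, not_or, not_le, sub_zero] at hc hp
    obtain ⟨⟨h1, h2⟩, h3⟩ := hc
    have h4 := abs_infoDensity_sub_le μ ha hS p
    have h5 := mul_lt_mul_of_pos_left (add_lt_add h1 h2) (half_pos ha')
    have h6 : (embeddingFactor n τ - 1) / 2 * (t / (2 * (embeddingFactor n τ - 1)) +
        t / (2 * (embeddingFactor n τ - 1))) = t / 2 := by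
      field_simp
      ring
    linarith
  have h := (measureReal_mono (μ := messageStegoLaw τ μ S) hsub).trans
    ((measureReal_union_le _ _).trans (add_le_add_left (measureReal_union_le _ _) _))
  have e : (8 * chiSqVariance * (embeddingFactor n τ - 1) ^ 2 + 4 * (embeddingFactor n τ - 1)) *
      n / t ^ 2 = 2 * (n * chiSqVariance / (t / (2 * (embeddingFactor n τ - 1))) ^ 2) +
        (embeddingFactor n τ - 1) * n / (t / 2) ^ 2 := by
    field_simp
    ring
  linarith

/-! ### The error exponent and the coding theorem -/

theorem randomCodeError_le_add_exp (ha : 1 < embeddingFactor n τ) (hS : S.PosDef)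
    {A : Set (Vec n × Vec n)} (hA : MeasurableSet A) {s t b : ℝ}
    (ht : ∀ p ∈ A, t ≤ infoDensity τ μ S p) (hb : (messageStegoLaw τ μ S).real Aᶜ ≤ b)
    {K : ℕ} (hK : K = ⌈Real.exp s⌉₊) :
    randomCodeError K A (messageLaw τ S) (coverLaw μ S) ≤ b + Real.exp (s - t) := by
  have hK1 : 1 ≤ K := by
    rw [hK]
    exact Nat.one_le_ceil_iff.mpr (Real.exp_pos s)
  -- Rounding up adds less than one codeword, which is absorbed by counting only the `K - 1`
  -- competitors.
  have hK2 : (K : ℝ) - 1 ≤ Real.exp s := by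
    rw [hK]
    linarith [Nat.ceil_lt_add_one (Real.exp_pos s).le]
  refine (randomCodeError_le hK1 hA _ _).trans (add_le_add hb ?_)
  rw [sub_eq_add_neg s t, Real.exp_add]
  exact mul_le_mul hK2 (independent_measure_le μ ha hS hA ht) measureReal_nonneg
    (Real.exp_pos s).le

end stego

end Stego

theorem mainTheorem3 :
    -- the mutual information in question, in closed form
    (∀ n : ℕ, 1 ≤ n → ∀ τ : ℝ, 0 < τ →
      ∀ (μ : Stego.Vec n) (S : Matrix (Fin n) (Fin n) ℝ), S.PosDef →
        Stego.stegoInfo τ μ S =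
          ENNReal.ofReal ((n : ℝ) / 2 * Real.log (Stego.embeddingFactor n τ))) ∧
    -- rates in nats per cover element, uniformly in the undetectability level
    (∀ ε δ γ : ℝ, 0 < ε → 0 < δ → 0 < γ → 3 * γ < 2 * ε →
      ∃ N : ℕ, 1 ≤ N ∧ ∀ n : ℕ, N ≤ n → ∀ τ : ℝ, 0 < τ →
        ∀ (μ : Stego.Vec n) (S : Matrix (Fin n) (Fin n) ℝ), S.PosDef →
          ∀ R : ℝ, R ≤ (Stego.stegoInfo τ μ S).toReal / n - 2 * ε →
            ∀ K : ℕ, K = ⌈Real.exp ((n : ℝ) * R)⌉₊ →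
              Stego.randomCodeError K (Stego.jointlyTypicalSet γ τ μ S)
                  (Stego.messageLaw τ S) (Stego.coverLaw μ S) ≤ 2 * δ ∧
              ∃ C : Fin K → Stego.Vec n,
                Stego.codebookError (Stego.jointlyTypicalSet γ τ μ S)
                  (Stego.coverLaw μ S) C ≤ 2 * δ) ∧
    -- rates in nats per square root of the number of elements, at a fixed undetectability level
    (∀ τ ε δ γ : ℝ, 0 < τ → 0 < ε → 0 < δ → 0 < γ →
      ∃ N : ℕ, 1 ≤ N ∧ ∀ n : ℕ, N ≤ n →
        ∀ (μ : Stego.Vec n) (S : Matrix (Fin n) (Fin n) ℝ), S.PosDef →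
          ∀ R : ℝ, R ≤ (Stego.stegoInfo τ μ S).toReal / Real.sqrt n - 2 * ε →
            ∀ K : ℕ, K = ⌈Real.exp (Real.sqrt n * R)⌉₊ →
              Stego.randomCodeError K (Stego.refinedTypicalSet γ (ε * Real.sqrt n) τ μ S)
                  (Stego.messageLaw τ S) (Stego.coverLaw μ S) ≤ 2 * δ ∧
              ∃ C : Fin K → Stego.Vec n,
                Stego.codebookError (Stego.refinedTypicalSet γ (ε * Real.sqrt n) τ μ S)
                  (Stego.coverLaw μ S) C ≤ 2 * δ) := by
  open Stego Filter in
  refine ⟨fun n hn τ hτ μ S hS => stegoInfo_eq μ (embeddingFactor_spec hn hτ).1 hS, ?_, ?_⟩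
  · intro ε δ γ _ hδ hγ hγε
    -- This error bound contains neither `τ` nor `μ`, `S`, so the resulting `N` is uniform in them;
    -- the exponent is negative since `3γ < 2ε`.
    have hlim : Tendsto (fun n : ℕ => 3 * chiSqVariance / γ ^ 2 / n +
        Real.exp (-((2 * ε - 3 * γ) * n))) atTop (nhds (0 + 0)) :=
      (tendsto_const_div_atTop_nhds_zero_nat _).add
        (Real.tendsto_exp_neg_atTop_nhds_zero.comp
          (tendsto_natCast_atTop_atTop.const_mul_atTop (by linarith)))
    rw [add_zero] at hlim
    obtain ⟨N, hN⟩ := eventually_atTop.mp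
      (hlim.eventually_le_const (show (0 : ℝ) < 2 * δ by linarith))
    refine ⟨max N 1, le_max_right _ _, fun n hn τ hτ μ S hS R hR K hK => ?_⟩
    have hn1 : 1 ≤ n := (le_max_right _ _).trans hn
    have hn0 : (0 : ℝ) < n := by exact_mod_cast hn1
    have ha := (embeddingFactor_spec hn1 hτ).1
    have hA := measurableSet_jointlyTypicalSet μ hn1 γ ha hS
    rw [stegoInfo_toReal μ ha hS] at hR
    have hR' : n * R ≤ n / 2 * Real.log (embeddingFactor n τ) - 2 * ε * n := by
      have h := mul_le_mul_of_nonneg_left hR hn0.le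
      rwa [mul_sub, mul_div_cancel₀ _ hn0.ne', mul_comm (n : ℝ) (2 * ε)] at h
    have h := randomCodeError_le_add_exp μ ha hS hA
      (fun p hp => infoDensity_ge_of_mem_jointlyTypicalSet μ hn1 ha hS hp)
      (atypical_le μ hn1 hγ ha hS) hK
    have hB : randomCodeError K (jointlyTypicalSet γ τ μ S) (messageLaw τ S) (coverLaw μ S) ≤
        2 * δ :=
      (h.trans (add_le_add_right (Real.exp_le_exp.mpr (by linarith)) _)).trans
        (hN n ((le_max_left _ _).trans hn))
    obtain ⟨C, hC⟩ := exists_codebookError_le (K := K) hA (messageLaw τ S) (coverLaw μ S)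
    exact ⟨hB, C, hC.trans hB⟩
  · intro τ ε δ γ hτ hε hδ hγ
    -- The middle term has lost its factor `n` to `(ε√n)²` and decays only through `a → 1`. The
    -- exponent is the rate gap `2ε√n` minus the slack `ε√n`.
    have hlim : Tendsto (fun n : ℕ => (3 * chiSqVariance / γ ^ 2 / n +
        (8 * chiSqVariance * (embeddingFactor n τ - 1) ^ 2 + 4 * (embeddingFactor n τ - 1)) /
          ε ^ 2) + Real.exp (-(ε * Real.sqrt n))) atTop (nhds (0 + 0 + 0)) := by
      refine ((tendsto_const_div_atTop_nhds_zero_nat _).add ?_).add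
        (Real.tendsto_exp_neg_atTop_nhds_zero.comp
          ((Real.tendsto_sqrt_atTop.comp tendsto_natCast_atTop_atTop).const_mul_atTop hε))
      have h1 : Tendsto (fun n : ℕ => embeddingFactor n τ - 1) atTop (nhds 0) := by
        simpa using (tendsto_embeddingFactor hτ).sub_const 1
      simpa using (((h1.pow 2).const_mul (8 * chiSqVariance)).add (h1.const_mul 4)).div_const
        (ε ^ 2)
    rw [add_zero, add_zero] at hlim
    obtain ⟨N, hN⟩ := eventually_atTop.mp
      (hlim.eventually_le_const (show (0 : ℝ) < 2 * δ by linarith))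
    refine ⟨max N 1, le_max_right _ _, fun n hn μ S hS R hR K hK => ?_⟩
    have hn1 : 1 ≤ n := (le_max_right _ _).trans hn
    have hn0 : (0 : ℝ) < n := by exact_mod_cast hn1
    have hs0 : 0 < Real.sqrt n := Real.sqrt_pos.mpr hn0
    have ha := (embeddingFactor_spec hn1 hτ).1
    have hA := measurableSet_refinedTypicalSet μ hn1 γ (ε * Real.sqrt n) ha hS
    rw [stegoInfo_toReal μ ha hS] at hR
    have hR' : Real.sqrt n * R ≤
        n / 2 * Real.log (embeddingFactor n τ) - 2 * ε * Real.sqrt n := by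
      have h := mul_le_mul_of_nonneg_left hR hs0.le
      rwa [mul_sub, mul_div_cancel₀ _ hs0.ne', mul_comm (Real.sqrt n) (2 * ε)] at h
    have ht : ∀ p ∈ refinedTypicalSet γ (ε * Real.sqrt n) τ μ S,
        n / 2 * Real.log (embeddingFactor n τ) - ε * Real.sqrt n ≤ infoDensity τ μ S p := by
      rintro p ⟨_, hp⟩
      rw [stegoInfo_toReal μ ha hS, abs_lt] at hp
      linarith
    have hcompl : (messageStegoLaw τ μ S).real (refinedTypicalSet γ (ε * Real.sqrt n) τ μ S)ᶜ ≤
        3 * chiSqVariance / γ ^ 2 / n +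
        (8 * chiSqVariance * (embeddingFactor n τ - 1) ^ 2 + 4 * (embeddingFactor n τ - 1)) /
          ε ^ 2 := by
      have hsub : (refinedTypicalSet γ (ε * Real.sqrt n) τ μ S)ᶜ ⊆
          (jointlyTypicalSet γ τ μ S)ᶜ ∪ {p | ε * Real.sqrt n ≤
            |infoDensity τ μ S p - n / 2 * Real.log (embeddingFactor n τ)|} := by
        intro p hp
        by_contra hc
        simp only [Set.mem_union, Set.mem_compl_iff, Set.mem_ofPred_eq, not_or, not_not,
          not_le] at hc
        rw [← stegoInfo_toReal μ ha hS] at hc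
        exact hp hc
      refine (measureReal_mono hsub).trans ((measureReal_union_le _ _).trans
        (add_le_add (atypical_le μ hn1 hγ ha hS)
          ((infoDensity_deviation_le μ ha hS (by positivity)).trans (le_of_eq ?_))))
      rw [mul_pow, Real.sq_sqrt hn0.le]
      field_simp
    have h := randomCodeError_le_add_exp μ ha hS hA ht hcompl hK
    have hB : randomCodeError K (refinedTypicalSet γ (ε * Real.sqrt n) τ μ S)
        (messageLaw τ S) (coverLaw μ S) ≤ 2 * δ :=
      (h.trans (add_le_add_right (Real.exp_le_exp.mpr (by linarith)) _)).trans
        (hN n ((le_max_left _ _).trans hn))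
    obtain ⟨C, hC⟩ := exists_codebookError_le (K := K) hA (messageLaw τ S) (coverLaw μ S)
    exact ⟨hB, C, hC.trans hB⟩
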